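/- Let $-\infty\le a<b\le\infty$ and let $p,q,r:(a,b)\to\mathbb R$ be measurable with $1/p,\,q,\,r\in L^1_{loc}((a,b);dx)$ and $p>0$, $r>0$ a.e. Write $f^{[1]}=pf'$, $\mathfrak D_\tau=\{f\in AC_{loc}((a,b)) : f^{[1]}\in AC_{loc}((a,b))\}$, $\tau f=\frac1r\big[-(f^{[1]})'+qf\big]$ and $W(f,g)=fg^{[1]}-f^{[1]}g$ for $f,g\in\mathfrak D_\tau$. In $L^2((a,b);r\,dx)$, with $(f,g)=\int_a^b \overline{f}\,g\,r\,dx$, let $T_{max}f=\tau f$ on $\operatorname{dom}T_{max}=\{f\in L^2((a,b);r\,dx): f\in\mathfrak D_\tau,\ \tau f\in L^2((a,b);r\,dx)\}$, and let $T_{min}$ be the closure of the restriction of $T_{max}$ to functions with compact support in $(a,b)$. Assume that $\tau$ is in the limit circle case at both $a$ and $b$ (for every $z\in\mathbb C$ all solutions of $\tau u=zu$ are in $L^2((a,b);r\,dx)$ near $a$ and near $b$) and that $T_{min}\ge\lambda_0 I$ for some $\lambda_0\in\mathbb R$. For $t\in\{a,b\}$ let $u_t$ and $\widehat u_t$ be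 a principal and a nonprincipal solution of $\tau u=\lambda_0u$ at $t$ with $W(\widehat u_t,u_t)=1$. Here a real-valued solution $u$ on $(a,b)$ is called principal at $t$ if there is a real-valued solution $v$ such that $u$ and $v$ do not vanish near $t$, $W(u,v)=1$, $u(x)=o(v(x))$ as $x\to t$, $\int p^{-1}u^{-2}\,dx=\infty$ and $\int p^{-1}v^{-2}\,dx<\infty$ near $t$; a real-valued solution is called nonprincipal at $t$ if it is linearly independent of a principal one at $t$. Let $a<a_0<b_0<b$ be such that $u_a,\widehat u_a$ have no zeros in $(a,a_0)$ and $u_b,\widehat u_b$ have no zeros in $(b_0,b)$, and let $c\in(a,a_0)$, $d\in(b_0,b)$. Put $N_tf=p^{1/2}\,\widehat u_t\,(f/\widehat u_t)'$. Define $$\operatorname{dom}\mathfrak Q_{c,d}=\big\{h\in L^2((a,b);r\,dx): h\in AC_{loc}((a,b)),\ p^{-1/2}h^{[1]}\in L^2((c,d);dx),\ N_ah\in L^2((a,c);dx),\ N_bh\in L^2((d,b);dx)\big\}$$ and, for $f,g\in\operatorname{dom}\mathfrak Q_{c,d}$, $$\begin{aligned}\mathfrak Q_{c,d}(f,g)={}&\int_a^c\overline{N_af}\,N_ag\,dx+\int_d^b\overline{N_bf}\,N_bg\,dx+\lambda_0\int_a^c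 r\overline fg\,dx+\lambda_0\int_d^b r\overline fg\,dx\\&+\int_c^d\big[p^{-1}\overline{f^{[1]}}g^{[1]}+q\overline fg\big]dx+\frac{\widehat u_a^{[1]}(c)}{\widehat u_a(c)}\overline{f(c)}g(c)-\frac{\widehat u_b^{[1]}(d)}{\widehat u_b(d)}\overline{f(d)}g(d).\end{aligned}$$ Let $f\in\operatorname{dom}\mathfrak Q_{c,d}$ and $g\in\operatorname{dom}T_{max}$. Then $g\in\operatorname{dom}\mathfrak Q_{c,d}$, the limits $$\widetilde f(t)=\lim_{x\to t}\frac{f(x)}{\widehat u_t(x)},\qquad \widetilde g^{\,\prime}(t)=\lim_{x\to t}W(\widehat u_t,g)(x),\qquad t\in\{a,b\},$$ exist and are finite, and $$(f,T_{max}g)=\mathfrak Q_{c,d}(f,g)+\overline{\widetilde f(a)}\,\widetilde g^{\,\prime}(a)-\overline{\widetilde f(b)}\,\widetilde g^{\,\prime}(b).$$ -/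

import Mathlib

open MeasureTheory Filter Topology
open scoped ComplexConjugate

/-- The standing data: an open interval `(a,b) ⊆ ℝ` with `-∞ ≤ a < b ≤ ∞`, and real-valued
coefficients `p, q, r`, measurable on `(a,b)`, with `1/p, q, r ∈ L¹_loc((a,b))` and
`p > 0`, `r > 0` a.e. on `(a,b)`. Values of the coefficients outside `(a,b)` never matter. -/
structure SturmLiouville where
  a : EReal
  b : EReal
  p : ℝ → ℝ
  q : ℝ → ℝ
  r : ℝ → ℝ
  a_lt_b : a < b
  measurable_p : AEMeasurable p (volume.restrict {x : ℝ | a < x ∧ x < b})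
  measurable_q : AEMeasurable q (volume.restrict {x : ℝ | a < x ∧ x < b})
  measurable_r : AEMeasurable r (volume.restrict {x : ℝ | a < x ∧ x < b})
  locInt_inv_p : LocallyIntegrableOn (fun x => (p x)⁻¹) {x : ℝ | a < x ∧ x < b} volume
  locInt_q : LocallyIntegrableOn q {x : ℝ | a < x ∧ x < b} volume
  locInt_r : LocallyIntegrableOn r {x : ℝ | a < x ∧ x < b} volume
  p_pos : ∀ᵐ x ∂(volume.restrict {x : ℝ | a < x ∧ x < b}), 0 < p x
  r_pos : ∀ᵐ x ∂(volume.restrict {x : ℝ | a < x ∧ x < b}), 0 < r x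

namespace SturmLiouville

noncomputable section

/-- The interval `(a,b)` as a set of reals. -/
def I (S : SturmLiouville) : Set ℝ := {x : ℝ | S.a < x ∧ x < S.b}

/-- The interval `(a,c)`. -/
def left (S : SturmLiouville) (c : ℝ) : Set ℝ := {x : ℝ | S.a < x ∧ x < c}

/-- The interval `(d,b)`. -/
def right (S : SturmLiouville) (d : ℝ) : Set ℝ := {x : ℝ | d < x ∧ x < S.b}

/-- The filter `x ↓ a` on `ℝ` (it is `atBot` if `a = -∞`). -/
def atLeft (S : SturmLiouville) : Filter ℝ := comap ((↑) : ℝ → EReal) (𝓝[>] S.a)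

/-- The filter `x ↑ b` on `ℝ` (it is `atTop` if `b = ∞`). -/
def atRight (S : SturmLiouville) : Filter ℝ := comap ((↑) : ℝ → EReal) (𝓝[<] S.b)

/-- The measure `r dx` on `(a,b)`. -/
def weight (S : SturmLiouville) : Measure ℝ :=
  (volume.restrict S.I).withDensity (fun x => ENNReal.ofReal (S.r x))

/-- `f ∈ AC_loc((a,b))`: absolutely continuous on every compact subinterval of `(a,b)`. -/
def ACloc (S : SturmLiouville) (f : ℝ → ℂ) : Prop :=
  ∀ x ∈ S.I, ∀ y ∈ S.I, AbsolutelyContinuousOnInterval f x y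

/-- `F` is the locally absolutely continuous representative of `p f'`. -/
def IsQuasiDeriv (S : SturmLiouville) (f F : ℝ → ℂ) : Prop :=
  S.ACloc F ∧ ∀ᵐ x ∂(volume.restrict S.I), F x = (S.p x : ℂ) * deriv f x

open Classical in
/-- The first quasi-derivative `f^[1] = p f'`. If `p f'` has a locally absolutely continuous
representative, this representative (unique on `(a,b)`) is taken, so that point values make sense;
otherwise it is the a.e. defined function `p f'`. -/
def quasiDeriv (S : SturmLiouville) (f : ℝ → ℂ) : ℝ → ℂ :=
  if h : ∃ F, S.IsQuasiDeriv f F then h.choose else fun x => (S.p x : ℂ) * deriv f x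

/-- The set `𝔇_τ((a,b))`. -/
def MemD (S : SturmLiouville) (f : ℝ → ℂ) : Prop :=
  S.ACloc f ∧ ∃ F, S.IsQuasiDeriv f F

/-- The differential expression `τ f = (1/r) (-(f^[1])' + q f)`. -/
def tau (S : SturmLiouville) (f : ℝ → ℂ) (x : ℝ) : ℂ :=
  ((S.r x)⁻¹ : ℝ) * (-deriv (S.quasiDeriv f) x + (S.q x : ℂ) * f x)

/-- The (modified) Wronskian `W(f,g) = f g^[1] - f^[1] g`. -/
def wronskian (S : SturmLiouville) (f g : ℝ → ℂ) (x : ℝ) : ℂ :=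
  f x * S.quasiDeriv g x - S.quasiDeriv f x * g x

/-- `f ∈ dom(T_max)`; there `T_max f = τ f`. -/
def MemDomMax (S : SturmLiouville) (f : ℝ → ℂ) : Prop :=
  MemLp f 2 S.weight ∧ S.MemD f ∧ MemLp (S.tau f) 2 S.weight

/-- The domain of the pre-minimal operator: `f ∈ dom(T_max)` with compact support in `(a,b)`. -/
def MemDomPreMin (S : SturmLiouville) (f : ℝ → ℂ) : Prop :=
  S.MemDomMax f ∧ ∃ K : Set ℝ, IsCompact K ∧ K ⊆ S.I ∧ ∀ x ∈ S.I, x ∉ K → f x = 0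

/-- The graph of the pre-minimal operator in the Hilbert space `L²((a,b); r dx)`. -/
def preMinGraph (S : SturmLiouville) : Set (Lp ℂ 2 S.weight × Lp ℂ 2 S.weight) :=
  {w | ∃ f : ℝ → ℂ, S.MemDomPreMin f ∧ w.1 =ᵐ[S.weight] f ∧ w.2 =ᵐ[S.weight] S.tau f}

/-- The graph of the minimal operator, the operator closure of the pre-minimal operator. -/
def minGraph (S : SturmLiouville) : Set (Lp ℂ 2 S.weight × Lp ℂ 2 S.weight) :=
  closure S.preMinGraph

/-- `T_min ≥ lam`: one has `(u, T_min u) ≥ lam (u,u)` for all `u ∈ dom(T_min)`. -/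
def MinBoundedBelow (S : SturmLiouville) (lam : ℝ) : Prop :=
  ∀ w ∈ S.minGraph, lam * ‖w.1‖ ^ 2 ≤ (inner ℂ w.1 w.2).re

/-- `u` is a solution of `τ u = z u` on `(a,b)`. -/
def IsSolution (S : SturmLiouville) (z : ℂ) (u : ℝ → ℂ) : Prop :=
  S.MemD u ∧ ∀ᵐ x ∂(volume.restrict S.I), S.tau u x = z * u x

/-- `u` is a real-valued solution of `τ u = lam u` on `(a,b)`. -/
def IsRealSolution (S : SturmLiouville) (lam : ℝ) (u : ℝ → ℂ) : Prop :=
  S.IsSolution lam u ∧ ∀ x ∈ S.I, (u x).im = 0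

/-- The limit circle case at `a`: for every `z`, all solutions of `τ u = z u` are in
`L²((a,b); r dx)` near `a`. -/
def LimitCircleLeft (S : SturmLiouville) : Prop :=
  ∀ (z : ℂ) (u : ℝ → ℂ), S.IsSolution z u →
    ∃ c ∈ S.I, MemLp u 2 (S.weight.restrict (Set.Iio c))

/-- The limit circle case at `b`. -/
def LimitCircleRight (S : SturmLiouville) : Prop :=
  ∀ (z : ℂ) (u : ℝ → ℂ), S.IsSolution z u →
    ∃ c ∈ S.I, MemLp u 2 (S.weight.restrict (Set.Ioi c))

/-- The integral of `p⁻¹ u⁻²` over a set, for real-valued `u` (then `u² = ‖u‖²`). -/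
def invSqIntegral (S : SturmLiouville) (u : ℝ → ℂ) (J : Set ℝ) : ENNReal :=
  ∫⁻ x in J, ENNReal.ofReal ((S.p x)⁻¹ * (‖u x‖ ^ 2)⁻¹)

/-- `u` is a principal solution of `τ u = lam u` at `a`: a real-valued solution that has a
real-valued companion `v` such that, near `a`, neither vanishes, `W(u,v) = 1`, `u = o(v)` as
`x ↓ a`, and `∫_a^c p⁻¹u⁻² = ∞`, `∫_a^c p⁻¹v⁻² < ∞`. -/
def IsPrincipalLeft (S : SturmLiouville) (lam : ℝ) (u : ℝ → ℂ) : Prop :=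
  S.IsRealSolution lam u ∧ ∃ v : ℝ → ℂ, S.IsRealSolution lam v ∧ ∃ c₀ ∈ S.I,
    (∀ x ∈ S.I, x ≤ c₀ → u x ≠ 0 ∧ v x ≠ 0) ∧
    (∀ x ∈ S.I, S.wronskian u v x = 1) ∧
    u =o[S.atLeft] v ∧
    ∀ c ∈ S.I, c ≤ c₀ → S.invSqIntegral u (S.left c) = ⊤ ∧ S.invSqIntegral v (S.left c) < ⊤

/-- `u` is a principal solution of `τ u = lam u` at `b`. -/
def IsPrincipalRight (S : SturmLiouville) (lam : ℝ) (u : ℝ → ℂ) : Prop :=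
  S.IsRealSolution lam u ∧ ∃ v : ℝ → ℂ, S.IsRealSolution lam v ∧ ∃ d₀ ∈ S.I,
    (∀ x ∈ S.I, d₀ ≤ x → u x ≠ 0 ∧ v x ≠ 0) ∧
    (∀ x ∈ S.I, S.wronskian u v x = 1) ∧
    u =o[S.atRight] v ∧
    ∀ d ∈ S.I, d₀ ≤ d → S.invSqIntegral u (S.right d) = ⊤ ∧ S.invSqIntegral v (S.right d) < ⊤

/-- `v` is a nonprincipal solution of `τ u = lam u` at `a`: a real-valued solution that is
linearly independent, on `(a,b)`, of a principal solution at `a`. -/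
def IsNonprincipalLeft (S : SturmLiouville) (lam : ℝ) (v : ℝ → ℂ) : Prop :=
  S.IsRealSolution lam v ∧ ∃ u, S.IsPrincipalLeft lam u ∧
    LinearIndependent ℂ ![S.I.domRestrict u, S.I.domRestrict v]

/-- `v` is a nonprincipal solution of `τ u = lam u` at `b`. -/
def IsNonprincipalRight (S : SturmLiouville) (lam : ℝ) (v : ℝ → ℂ) : Prop :=
  S.IsRealSolution lam v ∧ ∃ u, S.IsPrincipalRight lam u ∧
    LinearIndependent ℂ ![S.I.domRestrict u, S.I.domRestrict v]

/-- The differential expression `N_v f = p^{1/2} v (f/v)'`. -/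
def N (S : SturmLiouville) (v f : ℝ → ℂ) (x : ℝ) : ℂ :=
  (Real.sqrt (S.p x) : ℂ) * v x * deriv (fun y => f y / v y) x

/-- The domain of the sesquilinear form `𝔔_{c,d}` built from the solutions `va` near `a` and
`vb` near `b`. -/
def MemDomQ (S : SturmLiouville) (va vb : ℝ → ℂ) (c d : ℝ) (h : ℝ → ℂ) : Prop :=
  MemLp h 2 S.weight ∧ S.ACloc h ∧
  MemLp (fun x => ((Real.sqrt (S.p x))⁻¹ : ℂ) * S.quasiDeriv h x) 2
    (volume.restrict (Set.Ioo c d)) ∧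
  MemLp (S.N va h) 2 (volume.restrict (S.left c)) ∧
  MemLp (S.N vb h) 2 (volume.restrict (S.right d))

/-- The value `𝔔_{c,d}(f,g)`, antilinear in `f` and linear in `g`. -/
def Q (S : SturmLiouville) (lam : ℝ) (va vb : ℝ → ℂ) (c d : ℝ) (f g : ℝ → ℂ) : ℂ :=
  (∫ x in S.left c, conj (S.N va f x) * S.N va g x)
  + (∫ x in S.right d, conj (S.N vb f x) * S.N vb g x)
  + (lam : ℂ) * (∫ x in S.left c, (S.r x : ℂ) * (conj (f x) * g x))
  + (lam : ℂ) * (∫ x in S.right d, (S.r x : ℂ) * (conj (f x) * g x))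
  + (∫ x in Set.Ioo c d, (((S.p x)⁻¹ : ℝ) * (conj (S.quasiDeriv f x) * S.quasiDeriv g x)
      + (S.q x : ℂ) * (conj (f x) * g x)))
  + S.quasiDeriv va c / va c * (conj (f c) * g c)
  - S.quasiDeriv vb d / vb d * (conj (f d) * g d)

/-- The inner product `(f,g) = ∫ r(x) dx conj(f(x)) g(x)` of `L²((a,b); r dx)`. -/
def innerL2 (S : SturmLiouville) (f g : ℝ → ℂ) : ℂ :=
  ∫ x, conj (f x) * g x ∂S.weight

/-- The generalized boundary value `lim f/v` at an endpoint (given by the filter `l`), with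
respect to the nonprincipal solution `v` there, exists and equals `A`. -/
def HasBoundaryValue (l : Filter ℝ) (v f : ℝ → ℂ) (A : ℂ) : Prop :=
  Tendsto (fun x => f x / v x) l (𝓝 A)

/-- The generalized boundary derivative `lim W(v,g)` at an endpoint (given by the filter `l`),
with respect to the nonprincipal solution `v` there, exists and equals `A`. -/
def HasBoundaryDeriv (S : SturmLiouville) (l : Filter ℝ) (v g : ℝ → ℂ) (A : ℂ) : Prop :=
  Tendsto (fun x => S.wronskian v g x) l (𝓝 A)

/-- `f^[1] = p f'` a.e. on `(a,b)`, always. -/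
theorem quasiDeriv_ae_eq (S : SturmLiouville) (f : ℝ → ℂ) :
    ∀ᵐ x ∂(volume.restrict S.I), S.quasiDeriv f x = (S.p x : ℂ) * deriv f x := by
  unfold quasiDeriv
  split_ifs with h
  · exact h.choose_spec.2
  · exact Eventually.of_forall fun _ => rfl

theorem isOpen_I (S : SturmLiouville) : IsOpen S.I :=
  (isOpen_Ioo (a := S.a) (b := S.b)).preimage continuous_coe_real_ereal

theorem ACloc.continuousOn {S : SturmLiouville} {f : ℝ → ℂ} (hf : S.ACloc f) :
    ContinuousOn f S.I := by
  intro x hx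
  obtain ⟨ε, hε, hball⟩ := Metric.isOpen_iff.1 S.isOpen_I x hx
  have h1 : x - ε / 2 ∈ S.I := hball (by rw [Metric.mem_ball, Real.dist_eq, abs_lt]; constructor <;> linarith)
  have h2 : x + ε / 2 ∈ S.I := hball (by rw [Metric.mem_ball, Real.dist_eq, abs_lt]; constructor <;> linarith)
  have h := (hf _ h1 _ h2).continuousOn
  rw [Set.uIcc_of_le (by linarith)] at h
  exact (h.continuousAt (Icc_mem_nhds (by linarith) (by linarith))).continuousWithinAt

/-- The quasi-derivative is the only locally absolutely continuous representative of `p f'`. -/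
theorem IsQuasiDeriv.eqOn {S : SturmLiouville} {f F : ℝ → ℂ} (hF : S.IsQuasiDeriv f F) :
    Set.EqOn (S.quasiDeriv f) F S.I := by
  have h : ∃ F, S.IsQuasiDeriv f F := ⟨F, hF⟩
  have hq : S.IsQuasiDeriv f (S.quasiDeriv f) := by
    unfold quasiDeriv
    rw [dif_pos h]
    exact h.choose_spec
  refine Measure.eqOn_open_of_ae_eq (μ := volume) ?_ S.isOpen_I hq.1.continuousOn
    hF.1.continuousOn
  filter_upwards [hq.2, hF.2] with x h1 h2
  rw [h1, h2]

end

end SturmLiouville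

/-! Everything at an endpoint is read off from two quantities, with `v` the nonprincipal solution
there: the quotient `f / v` and the Wronskian `W(v,g)`. One has `(f/v)' = p^{-1/2} v⁻¹ N_v f`, a
product of two L² functions because `∫ p⁻¹ v⁻² < ∞`, and `W(v,g)' = r (λ₀ v g - v τg)`, which is
integrable because the limit circle case puts `v` in L². Both derivatives being integrable, both
quantities have limits. Moreover `N_v g = p^{-1/2} v⁻¹ W(v,g)` with a bounded Wronskian, so `g` lies
in the form domain.

The identity comes from `G = conj (f/v) * W(v,g)`, for which `G' = conj (N_v f) N_v g + λ₀ r conj f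
g - r conj f τg`. Integrating `G'` up to the endpoint gives the boundary term there
(`EndInterval.integral_conj_mul_tau`); at the base point `G` equals `conj f g^[1] - (v^[1]/v) conj f
g`. Ordinary integration by parts on `(c,d)` produces the opposite `conj f g^[1]` terms, which
cancel in the sum.

Finiteness of `∫ p⁻¹ v⁻²` is transferred from the companion `w` of the principal solution: the
Wronskian relations force `w = O(v)` (`eventually_norm_le_of_wronskian_eq_one`). -/

/-! ### Complex-valued absolutely continuous functions. -/

theorem IntervalIntegrable.complex_ofReal {f : ℝ → ℝ} {a b : ℝ} {μ : Measure ℝ}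
    (hf : IntervalIntegrable f μ a b) : IntervalIntegrable (fun x => (f x : ℂ)) μ a b :=
  ⟨hf.1.ofReal, hf.2.ofReal⟩

namespace AbsolutelyContinuousOnInterval

/-- A Lipschitz map enlarges each increment, hence each sum of increments, by at most the factor
`K`. Real and imaginary parts, conjugates and inverses are all special cases. -/
theorem lipschitzOnWith_comp {X Y : Type*} [PseudoMetricSpace X] [PseudoMetricSpace Y]
    {f : ℝ → X} {a b : ℝ} (hf : AbsolutelyContinuousOnInterval f a b) {φ : X → Y} {K : NNReal}
    (hφ : LipschitzOnWith K φ (f '' Set.uIcc a b)) :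
    AbsolutelyContinuousOnInterval (fun x => φ (f x)) a b := by
  have h : Tendsto (fun E : ℕ × (ℕ → ℝ × ℝ) =>
      K * ∑ i ∈ Finset.range E.1, dist (f (E.2 i).1) (f (E.2 i).2))
      (totalLengthFilter ⊓ 𝓟 (disjWithin a b)) (𝓝 0) := by
    simpa using Tendsto.const_mul (K : ℝ) hf
  refine squeeze_zero' (Eventually.of_forall fun t => Finset.sum_nonneg fun i _ => dist_nonneg)
    ?_ h
  filter_upwards [mem_inf_of_right (mem_principal_self _)] with E hE
  rw [Finset.mul_sum]
  refine Finset.sum_le_sum fun i hi => ?_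
  exact hφ.dist_le_mul _ (Set.mem_image_of_mem _ (hE.1 i hi).1) _
    (Set.mem_image_of_mem _ (hE.1 i hi).2)

variable {f g : ℝ → ℂ} {a b : ℝ}

theorem complex_re (hf : AbsolutelyContinuousOnInterval f a b) :
    AbsolutelyContinuousOnInterval (fun x => (f x).re) a b :=
  hf.lipschitzOnWith_comp (Complex.reCLM.lipschitz.lipschitzOnWith)

theorem complex_im (hf : AbsolutelyContinuousOnInterval f a b) :
    AbsolutelyContinuousOnInterval (fun x => (f x).im) a b :=
  hf.lipschitzOnWith_comp (Complex.imCLM.lipschitz.lipschitzOnWith)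

theorem complex_conj (hf : AbsolutelyContinuousOnInterval f a b) :
    AbsolutelyContinuousOnInterval (fun x => conj (f x)) a b :=
  hf.lipschitzOnWith_comp (Complex.conjCLE.toContinuousLinearMap.lipschitz.lipschitzOnWith)

theorem complex_mul (hf : AbsolutelyContinuousOnInterval f a b)
    (hg : AbsolutelyContinuousOnInterval g a b) :
    AbsolutelyContinuousOnInterval (fun x => f x * g x) a b :=
  hf.smul hg

theorem complex_inv (hf : AbsolutelyContinuousOnInterval f a b)
    (h0 : ∀ x ∈ Set.uIcc a b, f x ≠ 0) :
    AbsolutelyContinuousOnInterval (fun x => (f x)⁻¹) a b := by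
  obtain ⟨C, hC⟩ := isCompact_uIcc.exists_bound_of_continuousOn (hf.continuousOn.inv₀ h0)
  have hC0 : 0 ≤ C := (norm_nonneg _).trans (hC a Set.left_mem_uIcc)
  -- With `C` bounding `|1/f|` on the compact interval, the identity `1/s - 1/t = (1/s)(1/t)(t - s)`
  -- makes inversion Lipschitz with constant `C²` on the range of `f`.
  refine hf.lipschitzOnWith_comp (φ := fun z : ℂ => z⁻¹) (K := ⟨C * C, mul_nonneg hC0 hC0⟩)
    (LipschitzOnWith.of_dist_le_mul ?_)
  rintro _ ⟨x, hx, rfl⟩ _ ⟨y, hy, rfl⟩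
  have e : (f x)⁻¹ - (f y)⁻¹ = (f x)⁻¹ * (f y)⁻¹ * (f y - f x) := by
    field_simp [h0 x hx, h0 y hy]
  rw [dist_eq_norm, e, norm_mul, norm_mul, dist_comm, dist_eq_norm]
  change _ ≤ C * C * _
  gcongr
  · exact hC x hx
  · exact hC y hy

theorem complex_ae_differentiableAt (hf : AbsolutelyContinuousOnInterval f a b) :
    ∀ᵐ x : ℝ, x ∈ Set.uIcc a b → DifferentiableAt ℝ f x := by
  filter_upwards [hf.complex_re.ae_differentiableAt, hf.complex_im.ae_differentiableAt]
    with x h1 h2 hx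
  have h := ((Complex.ofRealCLM.differentiableAt.comp x (h1 hx))).add
    ((Complex.ofRealCLM.differentiableAt.comp x (h2 hx)).mul_const Complex.I)
  refine h.congr_of_eventuallyEq (Eventually.of_forall fun y => ?_)
  simp

theorem complex_deriv_ae_eq (hf : AbsolutelyContinuousOnInterval f a b) :
    ∀ᵐ x : ℝ, x ∈ Set.uIcc a b →
      deriv f x = ((deriv (fun y => (f y).re) x : ℝ) : ℂ)
        + ((deriv (fun y => (f y).im) x : ℝ) : ℂ) * Complex.I := by
  filter_upwards [hf.complex_ae_differentiableAt] with x hx hxm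
  have h := (hx hxm).hasDerivAt
  have h1 : HasDerivAt (fun y => (f y).re) (deriv f x).re x :=
    (Complex.reCLM.hasFDerivAt.comp_hasDerivAt x h)
  have h2 : HasDerivAt (fun y => (f y).im) (deriv f x).im x :=
    (Complex.imCLM.hasFDerivAt.comp_hasDerivAt x h)
  rw [h1.deriv, h2.deriv, Complex.re_add_im]

theorem complex_integral_deriv_eq_sub (hf : AbsolutelyContinuousOnInterval f a b) :
    ∫ x in a..b, deriv f x = f b - f a := by
  have h1 := hf.complex_re.intervalIntegrable_deriv.complex_ofReal
  have h2 := hf.complex_im.intervalIntegrable_deriv.complex_ofReal.mul_const Complex.I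
  rw [intervalIntegral.integral_congr_ae (g := fun x => ((deriv (fun y => (f y).re) x : ℝ) : ℂ)
        + ((deriv (fun y => (f y).im) x : ℝ) : ℂ) * Complex.I) ?_,
    intervalIntegral.integral_add h1 h2, intervalIntegral.integral_mul_const,
    intervalIntegral.integral_ofReal, intervalIntegral.integral_ofReal,
    hf.complex_re.integral_deriv_eq_sub, hf.complex_im.integral_deriv_eq_sub]
  · apply Complex.ext <;> simp
  · filter_upwards [hf.complex_deriv_ae_eq] with x hx hxm
    exact hx (Set.uIoc_subset_uIcc hxm)

end AbsolutelyContinuousOnInterval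

/-! ### The interval `(a,b)` and locally absolutely continuous functions. -/

namespace SturmLiouville

variable {S : SturmLiouville}

theorem ordConnected_I (S : SturmLiouville) : S.I.OrdConnected :=
  ⟨fun _ hx _ hy _ hz => ⟨hx.1.trans_le (EReal.coe_le_coe_iff.2 hz.1),
    (EReal.coe_le_coe_iff.2 hz.2).trans_lt hy.2⟩⟩

theorem uIcc_subset_I {x y : ℝ} (hx : x ∈ S.I) (hy : y ∈ S.I) : Set.uIcc x y ⊆ S.I :=
  S.ordConnected_I.uIcc_subset hx hy

theorem Icc_subset_I {x y : ℝ} (hx : x ∈ S.I) (hy : y ∈ S.I) : Set.Icc x y ⊆ S.I :=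
  S.ordConnected_I.out hx hy

theorem measurableSet_I (S : SturmLiouville) : MeasurableSet S.I := S.isOpen_I.measurableSet

/-- Intervals with rational endpoints cover `(a,b)` and are countably many, so their exceptional
null sets have a null union. -/
theorem ae_restrict_I_of_forall_uIcc {P : ℝ → Prop}
    (h : ∀ x ∈ S.I, ∀ y ∈ S.I, ∀ᵐ t : ℝ, t ∈ Set.uIcc x y → P t) :
    ∀ᵐ t ∂(volume.restrict S.I), P t := by
  rw [ae_restrict_iff' S.measurableSet_I]
  have h' : ∀ᵐ t : ℝ, ∀ x y : ℚ, (x : ℝ) ∈ S.I → (y : ℝ) ∈ S.I →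
      t ∈ Set.uIcc (x : ℝ) y → P t := by
    simp only [ae_all_iff]
    exact fun x y hx hy => h _ hx _ hy
  filter_upwards [h'] with t ht htI
  obtain ⟨x, hx, hx'⟩ := EReal.exists_rat_btwn_of_lt htI.1
  obtain ⟨y, hy, hy'⟩ := EReal.exists_rat_btwn_of_lt htI.2
  have hxt : (x : ℝ) < t := by exact_mod_cast hx'
  have hty : t < (y : ℝ) := by exact_mod_cast hy
  exact ht x y ⟨by exact_mod_cast hx, (by exact_mod_cast hx' : ((x : ℝ) : EReal) < t).trans htI.2⟩
    ⟨htI.1.trans (by exact_mod_cast hy : (t : EReal) < ((y : ℝ) : EReal)), by exact_mod_cast hy'⟩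
    (Set.mem_uIcc_of_le hxt.le hty.le)

namespace ACloc

variable {f g : ℝ → ℂ}

theorem ae_differentiableAt (hf : S.ACloc f) :
    ∀ᵐ x ∂(volume.restrict S.I), DifferentiableAt ℝ f x :=
  ae_restrict_I_of_forall_uIcc fun x hx y hy => (hf x hx y hy).complex_ae_differentiableAt

theorem mul (hf : S.ACloc f) (hg : S.ACloc g) : S.ACloc (fun x => f x * g x) :=
  fun x hx y hy => (hf x hx y hy).complex_mul (hg x hx y hy)

theorem sub (hf : S.ACloc f) (hg : S.ACloc g) : S.ACloc (fun x => f x - g x) :=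
  fun x hx y hy => (hf x hx y hy).sub (hg x hx y hy)

theorem star_comp (hf : S.ACloc f) : S.ACloc (fun x => conj (f x)) :=
  fun x hx y hy => (hf x hx y hy).complex_conj

theorem eq_of_ae_deriv_eq_zero (hf : S.ACloc f)
    (h : ∀ᵐ x ∂(volume.restrict S.I), deriv f x = 0) {x y : ℝ} (hx : x ∈ S.I) (hy : y ∈ S.I) :
    f x = f y := by
  have h1 := (hf y hy x hx).complex_integral_deriv_eq_sub
  rw [intervalIntegral.integral_congr_ae (g := fun _ => (0 : ℂ)),
    intervalIntegral.integral_zero] at h1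
  · exact (sub_eq_zero.1 h1.symm)
  · rw [ae_restrict_iff' S.measurableSet_I] at h
    filter_upwards [h] with t ht htm
    exact ht (uIcc_subset_I hy hx (Set.uIoc_subset_uIcc htm))

end ACloc

/-! ### One-sided neighbourhoods of the endpoints, treated uniformly. -/

/-- `J` is a one-sided neighbourhood in `(a,b)` of an endpoint, with base point `c`; `l` is the
filter of that endpoint and the sign `σ` is `1` at `a` and `-1` at `b`. -/
structure EndInterval (S : SturmLiouville) (J : Set ℝ) (l : Filter ℝ) (c : ℝ) (σ : ℂ) : Prop where
  measurableSet : MeasurableSet J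
  subset : J ⊆ S.I
  base_mem : c ∈ S.I
  uIcc_subset : ∀ x ∈ J, Set.uIcc x c ⊆ insert c J
  neBot : l.NeBot
  sign_sq : σ * σ = 1
  tendsto : ∀ F : ℝ → ℂ, (∀ x ∈ J, AbsolutelyContinuousOnInterval F x c) →
    IntegrableOn (deriv F) J → Tendsto F l (𝓝 (F c - σ * ∫ x in J, deriv F x))

theorem neBot_atLeft (S : SturmLiouville) : S.atLeft.NeBot := by
  refine comap_neBot fun t ht => ?_
  obtain ⟨u, hu, hut⟩ := (mem_nhdsGT_iff_exists_Ioo_subset' S.a_lt_b).1 ht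
  obtain ⟨x, hx, hx'⟩ := EReal.lt_iff_exists_real_btwn.1 hu
  exact ⟨x, hut ⟨hx, hx'⟩⟩

theorem neBot_atRight (S : SturmLiouville) : S.atRight.NeBot := by
  refine comap_neBot fun t ht => ?_
  obtain ⟨u, hu, hut⟩ := (mem_nhdsLT_iff_exists_Ioo_subset' S.a_lt_b).1 ht
  obtain ⟨x, hx, hx'⟩ := EReal.lt_iff_exists_real_btwn.1 hu
  exact ⟨x, hut ⟨hx, hx'⟩⟩

theorem left_mem_atLeft {c : ℝ} (hc : c ∈ S.I) : S.left c ∈ S.atLeft :=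
  ⟨_, Ioo_mem_nhdsGT hc.1, fun _ hx => ⟨hx.1, EReal.coe_lt_coe_iff.1 hx.2⟩⟩

theorem right_mem_atRight {d : ℝ} (hd : d ∈ S.I) : S.right d ∈ S.atRight :=
  ⟨_, Ioo_mem_nhdsLT hd.2, fun _ hx => ⟨EReal.coe_lt_coe_iff.1 hx.1, hx.2⟩⟩

theorem exists_left_of_eventually {P : ℝ → Prop} (h : ∀ᶠ x in S.atLeft, P x) {c : ℝ}
    (hc : c ∈ S.I) : ∃ e ∈ S.I, e ≤ c ∧ ∀ x ∈ S.left e, P x := by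
  obtain ⟨t, ht, hP⟩ := h
  obtain ⟨u, hu, hut⟩ := (mem_nhdsGT_iff_exists_Ioo_subset' hc.1).1 ht
  obtain ⟨x, hx, hx'⟩ := EReal.lt_iff_exists_real_btwn.1 (lt_min hu hc.1)
  have hxc : x < c := EReal.coe_lt_coe_iff.1 (hx'.trans_le (min_le_right _ _))
  exact ⟨x, ⟨hx, (EReal.coe_lt_coe_iff.2 hxc).trans hc.2⟩, hxc.le, fun y hy =>
    hP (hut ⟨hy.1, (EReal.coe_lt_coe_iff.2 hy.2).trans (hx'.trans_le (min_le_left _ _))⟩)⟩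

theorem exists_right_of_eventually {P : ℝ → Prop} (h : ∀ᶠ x in S.atRight, P x) {d : ℝ}
    (hd : d ∈ S.I) : ∃ e ∈ S.I, d ≤ e ∧ ∀ x ∈ S.right e, P x := by
  obtain ⟨t, ht, hP⟩ := h
  obtain ⟨u, hu, hut⟩ := (mem_nhdsLT_iff_exists_Ioo_subset' hd.2).1 ht
  obtain ⟨x, hx', hx⟩ := EReal.lt_iff_exists_real_btwn.1 (max_lt hu hd.2)
  have hxc : d < x := EReal.coe_lt_coe_iff.1 ((le_max_right _ _).trans_lt hx')
  exact ⟨x, ⟨hd.1.trans (EReal.coe_lt_coe_iff.2 hxc), hx⟩, hxc.le, fun y hy =>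
    hP (hut ⟨((le_max_left _ _).trans_lt hx').trans (EReal.coe_lt_coe_iff.2 hy.1), hy.2⟩)⟩

theorem left_subset_I {c : ℝ} (hc : c ∈ S.I) : S.left c ⊆ S.I :=
  fun _ hx => ⟨hx.1, (EReal.coe_lt_coe_iff.2 hx.2).trans hc.2⟩

theorem right_subset_I {d : ℝ} (hd : d ∈ S.I) : S.right d ⊆ S.I :=
  fun _ hx => ⟨hd.1.trans (EReal.coe_lt_coe_iff.2 hx.1), hx.2⟩

theorem measurableSet_left (S : SturmLiouville) (c : ℝ) : MeasurableSet (S.left c) :=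
  (measurableSet_Ioi.preimage measurable_coe_real_ereal).inter measurableSet_Iio

theorem measurableSet_right (S : SturmLiouville) (d : ℝ) : MeasurableSet (S.right d) :=
  measurableSet_Ioi.inter (measurableSet_Iio.preimage measurable_coe_real_ereal)

theorem endInterval_left {c : ℝ} (hc : c ∈ S.I) : S.EndInterval (S.left c) S.atLeft c 1 where
  measurableSet := S.measurableSet_left c
  subset := left_subset_I hc
  base_mem := hc
  uIcc_subset x hx y hy := by
    rw [Set.uIcc_of_le hx.2.le] at hy
    rcases hy.2.eq_or_lt with h | h
    · exact Or.inl h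
    · exact Or.inr ⟨hx.1.trans_le (EReal.coe_le_coe_iff.2 hy.1), h⟩
  neBot := S.neBot_atLeft
  sign_sq := one_mul 1
  tendsto F hF hint := by
    have : S.atLeft.IsCountablyGenerated := by unfold atLeft; infer_instance
    -- The intervals `(x,c)` exhaust `(a,c)` as `x ↓ a`, so the integrals given by the fundamental
    -- theorem on each of them converge to the integral over `(a,c)`.
    have hcov : AECover (volume.restrict (S.left c)) S.atLeft (fun x => Set.Ioo x c) :=
      aecover_restrict_of_ae_imp (S.measurableSet_left c)
        (Eventually.of_forall fun x hx => mem_of_superset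
          (left_mem_atLeft (left_subset_I hc hx)) fun y hy => ⟨hy.2, hx.2⟩)
        fun _ => measurableSet_Ioo
    have h := (hcov.integral_tendsto_of_countably_generated hint).const_sub (F c)
    rw [one_mul]
    refine h.congr' ?_
    filter_upwards [left_mem_atLeft hc] with x hx
    have e : Set.Ioo x c ∩ S.left c = Set.Ioo x c :=
      Set.inter_eq_left.2 fun y hy => ⟨hx.1.trans (EReal.coe_lt_coe_iff.2 hy.1), hy.2⟩
    rw [Measure.restrict_restrict measurableSet_Ioo, e, ← integral_Ioc_eq_integral_Ioo,
      ← intervalIntegral.integral_of_le hx.2.le, (hF x hx).complex_integral_deriv_eq_sub]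
    ring

theorem endInterval_right {d : ℝ} (hd : d ∈ S.I) :
    S.EndInterval (S.right d) S.atRight d (-1) where
  measurableSet := S.measurableSet_right d
  subset := right_subset_I hd
  base_mem := hd
  uIcc_subset x hx y hy := by
    rw [Set.uIcc_of_ge hx.1.le] at hy
    rcases hy.1.eq_or_lt with h | h
    · exact Or.inl h.symm
    · exact Or.inr ⟨h, (EReal.coe_le_coe_iff.2 hy.2).trans_lt hx.2⟩
  neBot := S.neBot_atRight
  sign_sq := by norm_num
  tendsto F hF hint := by
    have : S.atRight.IsCountablyGenerated := by unfold atRight; infer_instance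
    have hcov : AECover (volume.restrict (S.right d)) S.atRight (fun x => Set.Ioo d x) :=
      aecover_restrict_of_ae_imp (S.measurableSet_right d)
        (Eventually.of_forall fun x hx => mem_of_superset
          (right_mem_atRight (right_subset_I hd hx)) fun y hy => ⟨hx.1, hy.1⟩)
        fun _ => measurableSet_Ioo
    have h := (hcov.integral_tendsto_of_countably_generated hint).const_add (F d)
    rw [neg_one_mul, sub_neg_eq_add]
    refine h.congr' ?_
    filter_upwards [right_mem_atRight hd] with x hx
    have e : Set.Ioo d x ∩ S.right d = Set.Ioo d x :=
      Set.inter_eq_left.2 fun y hy => ⟨hy.1, (EReal.coe_lt_coe_iff.2 hy.2).trans hx.2⟩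
    rw [Measure.restrict_restrict measurableSet_Ioo, e, ← integral_Ioc_eq_integral_Ioo,
      ← intervalIntegral.integral_of_le hx.1.le, (hF x hx).symm.complex_integral_deriv_eq_sub]
    ring

/-! ### The weight, quasi-derivatives and the Wronskian. -/

theorem MemD.isQuasiDeriv {f : ℝ → ℂ} (hf : S.MemD f) : S.IsQuasiDeriv f (S.quasiDeriv f) := by
  unfold quasiDeriv
  rw [dif_pos hf.2]
  exact hf.2.choose_spec

theorem weight_restrict {J : Set ℝ} (hJ : MeasurableSet J) (hJI : J ⊆ S.I) :
    S.weight.restrict J =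
      (volume.restrict J).withDensity (fun x => ENNReal.ofReal (S.r x)) := by
  rw [weight, restrict_withDensity hJ, Measure.restrict_restrict hJ, Set.inter_eq_left.2 hJI]

theorem aemeasurable_ofReal_r {J : Set ℝ} (hJI : J ⊆ S.I) :
    AEMeasurable (fun x => ENNReal.ofReal (S.r x)) (volume.restrict J) :=
  (S.measurable_r.mono_measure (Measure.restrict_mono_set _ hJI)).ennreal_ofReal

theorem r_smul_ae_eq {J : Set ℝ} (hJI : J ⊆ S.I) (F : ℝ → ℂ) :
    (fun x => (ENNReal.ofReal (S.r x)).toReal • F x) =ᵐ[volume.restrict J]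
      fun x => (S.r x : ℂ) * F x := by
  filter_upwards [ae_restrict_of_ae_restrict_of_subset hJI S.r_pos] with x hx
  rw [ENNReal.toReal_ofReal hx.le, Complex.real_smul]

theorem integrable_weight_restrict_iff {J : Set ℝ} (hJ : MeasurableSet J) (hJI : J ⊆ S.I)
    {F : ℝ → ℂ} :
    Integrable F (S.weight.restrict J) ↔ IntegrableOn (fun x => (S.r x : ℂ) * F x) J := by
  rw [weight_restrict hJ hJI, integrable_withDensity_iff_integrable_smul₀'
    (aemeasurable_ofReal_r hJI) (Eventually.of_forall fun _ => ENNReal.ofReal_lt_top)]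
  exact integrable_congr (r_smul_ae_eq hJI F)

theorem integral_weight (S : SturmLiouville) (F : ℝ → ℂ) :
    ∫ x, F x ∂S.weight = ∫ x in S.I, (S.r x : ℂ) * F x := by
  rw [weight, integral_withDensity_eq_integral_toReal_smul₀
    (aemeasurable_ofReal_r subset_rfl) (Eventually.of_forall fun _ => ENNReal.ofReal_lt_top)]
  exact integral_congr_ae (r_smul_ae_eq subset_rfl F)

theorem integrableOn_r_mul {J : Set ℝ} (hJ : MeasurableSet J) (hJI : J ⊆ S.I) {f g : ℝ → ℂ}
    (hf : MemLp f 2 (S.weight.restrict J)) (hg : MemLp g 2 (S.weight.restrict J)) :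
    IntegrableOn (fun x => (S.r x : ℂ) * (f x * g x)) J :=
  (integrable_weight_restrict_iff hJ hJI).1 (hf.integrable_mul hg)

theorem memLp_conj {f : ℝ → ℂ} {μ : Measure ℝ} {s : ENNReal} (hf : MemLp f s μ) :
    MemLp (fun x => conj (f x)) s μ :=
  hf.star

/-- The pointwise facts about elements of `𝔇_τ` that hold almost everywhere. -/
theorem MemD.ae_hasDerivAt {f : ℝ → ℂ} (hf : S.MemD f) :
    ∀ᵐ x ∂(volume.restrict S.I),
      HasDerivAt f ((S.p x : ℂ)⁻¹ * S.quasiDeriv f x) x ∧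
      HasDerivAt (S.quasiDeriv f) (S.q x * f x - S.r x * S.tau f x) x := by
  filter_upwards [hf.1.ae_differentiableAt, hf.isQuasiDeriv.1.ae_differentiableAt,
    S.quasiDeriv_ae_eq f, S.p_pos, S.r_pos] with x h1 h2 h3 hp hr
  have hp' : (S.p x : ℂ) ≠ 0 := by exact_mod_cast hp.ne'
  have hr' : (S.r x : ℂ) ≠ 0 := by exact_mod_cast hr.ne'
  constructor
  · refine HasDerivAt.congr_deriv (h1.hasDerivAt) ?_
    rw [h3]; field_simp
  · refine HasDerivAt.congr_deriv (h2.hasDerivAt) ?_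
    rw [tau]; push_cast; field_simp; ring

theorem ACloc.wronskian {f g : ℝ → ℂ} (hf : S.MemD f) (hg : S.MemD g) :
    S.ACloc (S.wronskian f g) :=
  (hf.1.mul hg.isQuasiDeriv.1).sub (hf.isQuasiDeriv.1.mul hg.1)

/-- Lagrange's identity: in the product rule the terms with `p⁻¹ f^[1] g^[1]` and those with `q f g`
cancel. -/
theorem ae_hasDerivAt_wronskian {f g : ℝ → ℂ} (hf : S.MemD f) (hg : S.MemD g) :
    ∀ᵐ x ∂(volume.restrict S.I), HasDerivAt (S.wronskian f g)
      (S.r x * (S.tau f x * g x - f x * S.tau g x)) x := by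
  filter_upwards [hf.ae_hasDerivAt, hg.ae_hasDerivAt] with x h1 h2
  refine HasDerivAt.congr_deriv ((h1.1.mul h2.2).sub (h1.2.mul h2.1)) ?_
  ring

theorem wronskian_const {z : ℂ} {f g : ℝ → ℂ} (hf : S.IsSolution z f) (hg : S.IsSolution z g)
    {x y : ℝ} (hx : x ∈ S.I) (hy : y ∈ S.I) : S.wronskian f g x = S.wronskian f g y := by
  refine (ACloc.wronskian hf.1 hg.1).eq_of_ae_deriv_eq_zero ?_ hx hy
  filter_upwards [ae_hasDerivAt_wronskian hf.1 hg.1, hf.2, hg.2] with x h1 h2 h3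
  rw [h1.deriv, h2, h3]; ring

/-- The squared norm of the function is the integrand of `invSqIntegral`. This turns nonprincipality
into an L² statement fit for Cauchy–Schwarz. -/
theorem memLp_inv_sqrt_mul_inv {v : ℝ → ℂ} {J : Set ℝ} (hJ : MeasurableSet J) (hJI : J ⊆ S.I)
    (hv : ContinuousOn v J) (hv0 : ∀ x ∈ J, v x ≠ 0) (hint : S.invSqIntegral v J < ⊤) :
    MemLp (fun x => (Real.sqrt (S.p x) : ℂ)⁻¹ * (v x)⁻¹) 2 (volume.restrict J) := by
  have hp : AEMeasurable S.p (volume.restrict J) :=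
    S.measurable_p.mono_measure (Measure.restrict_mono_set _ hJI)
  have hm : AEStronglyMeasurable (fun x => (Real.sqrt (S.p x) : ℂ)⁻¹ * (v x)⁻¹)
      (volume.restrict J) :=
    (Complex.measurable_ofReal.comp_aemeasurable hp.sqrt).inv.aestronglyMeasurable.mul
      ((hv.inv₀ hv0).aestronglyMeasurable hJ)
  refine (memLp_two_iff_integrable_sq_norm hm).2 ⟨(hm.norm.pow 2), ?_⟩
  refine lt_of_le_of_lt (le_of_eq ?_) hint
  refine lintegral_congr_ae ?_
  filter_upwards [ae_restrict_of_ae_restrict_of_subset hJI S.p_pos] with x hx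
  rw [Real.enorm_of_nonneg (by positivity), norm_mul, norm_inv, norm_inv, mul_pow, inv_pow,
    inv_pow, Complex.norm_real, Real.norm_of_nonneg (Real.sqrt_nonneg _), Real.sq_sqrt hx.le]

/-! ### Boundary values and integration by parts near one endpoint. -/

namespace EndInterval

variable {J : Set ℝ} {l : Filter ℝ} {c : ℝ} {σ : ℂ} {v : ℝ → ℂ}

theorem absolutelyContinuous_div (h : S.EndInterval J l c σ) (hv : S.ACloc v)
    (hv0 : ∀ x ∈ insert c J, v x ≠ 0) {f : ℝ → ℂ} (hf : S.ACloc f) :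
    ∀ x ∈ J, AbsolutelyContinuousOnInterval (fun y => f y / v y) x c := by
  intro x hx
  have hxI := h.subset hx
  simp only [div_eq_mul_inv]
  exact (hf x hxI c h.base_mem).complex_mul
    ((hv x hxI c h.base_mem).complex_inv fun y hy => hv0 y (h.uIcc_subset x hx hy))

theorem ae_of_ae (h : S.EndInterval J l c σ) {P : ℝ → Prop}
    (hP : ∀ᵐ x ∂(volume.restrict S.I), P x) : ∀ᵐ x ∂(volume.restrict J), P x :=
  ae_restrict_of_ae_restrict_of_subset h.subset hP

theorem ae_hasDerivAt_div (h : S.EndInterval J l c σ) (hv : S.ACloc v)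
    (hv0 : ∀ x ∈ insert c J, v x ≠ 0) {f : ℝ → ℂ} (hf : S.ACloc f) :
    ∀ᵐ x ∂(volume.restrict J), HasDerivAt (fun y => f y / v y)
      ((Real.sqrt (S.p x) : ℂ)⁻¹ * (v x)⁻¹ * S.N v f x) x := by
  filter_upwards [h.ae_of_ae hf.ae_differentiableAt, h.ae_of_ae hv.ae_differentiableAt,
    h.ae_of_ae S.p_pos, ae_restrict_mem h.measurableSet] with x h1 h2 hp hx
  have hvx := hv0 x (Or.inr hx)
  have hp' : (Real.sqrt (S.p x) : ℂ) ≠ 0 := by exact_mod_cast (Real.sqrt_pos.2 hp).ne'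
  refine HasDerivAt.congr_deriv ((h1.fun_div h2 hvx).hasDerivAt) ?_
  rw [N]
  field_simp

/-- By Cauchy–Schwarz `(f/v)'` is integrable up to the endpoint, as a product of `p^{-1/2} v⁻¹` and
`N_v f`. -/
theorem exists_boundaryValue (h : S.EndInterval J l c σ) (hv : S.ACloc v)
    (hv0 : ∀ x ∈ insert c J, v x ≠ 0) (hint : S.invSqIntegral v J < ⊤) {f : ℝ → ℂ}
    (hf : S.ACloc f) (hN : MemLp (S.N v f) 2 (volume.restrict J)) :
    ∃ A, HasBoundaryValue l v f A := by
  refine ⟨_, h.tendsto _ (h.absolutelyContinuous_div hv hv0 hf) ?_⟩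
  have h1 := memLp_inv_sqrt_mul_inv h.measurableSet h.subset (hv.continuousOn.mono h.subset)
    (fun x hx => hv0 x (Or.inr hx)) hint
  refine (h1.integrable_mul hN).congr ?_
  filter_upwards [h.ae_hasDerivAt_div hv hv0 hf] with x hx
  exact hx.deriv.symm

theorem ae_hasDerivAt_wronskian_solution (h : S.EndInterval J l c σ) {z : ℂ}
    (hv : S.IsSolution z v) {g : ℝ → ℂ} (hg : S.MemD g) :
    ∀ᵐ x ∂(volume.restrict J), HasDerivAt (S.wronskian v g)
      (z * (S.r x * (v x * g x)) - S.r x * (v x * S.tau g x)) x := by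
  filter_upwards [h.ae_of_ae (ae_hasDerivAt_wronskian hv.1 hg), h.ae_of_ae hv.2] with x h1 h2
  refine HasDerivAt.congr_deriv (h1) ?_
  rw [h2]; ring

theorem integrableOn_deriv_wronskian (h : S.EndInterval J l c σ) {z : ℂ}
    (hv : S.IsSolution z v) (hv2 : MemLp v 2 (S.weight.restrict J)) {g : ℝ → ℂ}
    (hg : S.MemDomMax g) : IntegrableOn (deriv (S.wronskian v g)) J := by
  refine (((integrableOn_r_mul h.measurableSet h.subset hv2 (hg.1.restrict J)).const_mul z).sub
    (integrableOn_r_mul h.measurableSet h.subset hv2 (hg.2.2.restrict J))).congr ?_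
  filter_upwards [h.ae_hasDerivAt_wronskian_solution hv hg.2.1] with x hx
  exact hx.deriv.symm

theorem exists_boundaryDeriv (h : S.EndInterval J l c σ) {z : ℂ} (hv : S.IsSolution z v)
    (hv2 : MemLp v 2 (S.weight.restrict J)) {g : ℝ → ℂ} (hg : S.MemDomMax g) :
    ∃ A, S.HasBoundaryDeriv l v g A :=
  ⟨_, h.tendsto _ (fun x hx => ACloc.wronskian hv.1 hg.2.1 x (h.subset hx) c h.base_mem)
    (h.integrableOn_deriv_wronskian hv hv2 hg)⟩

/-- Away from the zeros of `v`, `N_v g = p^{-1/2} v⁻¹ W(v,g)`. -/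
theorem ae_N_eq (h : S.EndInterval J l c σ) (hv : S.MemD v)
    (hv0 : ∀ x ∈ insert c J, v x ≠ 0) {g : ℝ → ℂ} (hg : S.MemD g) :
    ∀ᵐ x ∂(volume.restrict J),
      S.N v g x = (Real.sqrt (S.p x) : ℂ)⁻¹ * (v x)⁻¹ * S.wronskian v g x := by
  filter_upwards [h.ae_of_ae hv.ae_hasDerivAt, h.ae_of_ae hg.ae_hasDerivAt,
    h.ae_of_ae S.p_pos, ae_restrict_mem h.measurableSet] with x h1 h2 hp hx
  have hvx := hv0 x (Or.inr hx)
  have hs : (Real.sqrt (S.p x) : ℂ) ≠ 0 := by exact_mod_cast (Real.sqrt_pos.2 hp).ne'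
  have hss : (S.p x : ℂ) = Real.sqrt (S.p x) * Real.sqrt (S.p x) := by
    exact_mod_cast (Real.mul_self_sqrt hp.le).symm
  have hd : deriv (fun y => g y / v y) x = _ := (h2.1.div h1.1 hvx).deriv
  rw [N, hd, wronskian, hss]
  field_simp

/-- The value at the base point plus the L¹ norm of the derivative is a uniform bound. -/
theorem exists_bound_wronskian (h : S.EndInterval J l c σ) {z : ℂ} (hv : S.IsSolution z v)
    (hv2 : MemLp v 2 (S.weight.restrict J)) {g : ℝ → ℂ} (hg : S.MemDomMax g) :
    ∃ C, ∀ x ∈ J, ‖S.wronskian v g x‖ ≤ C := by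
  have hint := h.integrableOn_deriv_wronskian hv hv2 hg
  refine ⟨‖S.wronskian v g c‖ + ∫ x in J, ‖deriv (S.wronskian v g) x‖, fun x hx => ?_⟩
  have e := (ACloc.wronskian hv.1 hg.2.1 c h.base_mem x
    (h.subset hx)).complex_integral_deriv_eq_sub
  have e' : S.wronskian v g x = S.wronskian v g c + ∫ t in c..x, deriv (S.wronskian v g) t := by
    rw [e]; ring
  rw [e']
  refine (norm_add_le _ _).trans (add_le_add_right ?_ _)
  refine intervalIntegral.norm_integral_le_integral_norm_uIoc.trans ?_
  refine setIntegral_mono_set hint.norm (Eventually.of_forall fun _ => norm_nonneg _) ?_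
  -- The segment from `x` to `c` lies in `J` except for its endpoint `c`, which is a null set.
  have h0 : ∀ᵐ t : ℝ, t ≠ c := by simp [ae_iff, measure_singleton]
  filter_upwards [h0] with t ht htm
  rw [Set.uIoc_comm] at htm
  exact (h.uIcc_subset x hx (Set.uIoc_subset_uIcc htm)).resolve_left ht

/-- By `ae_N_eq` the function is the L² function `p^{-1/2} v⁻¹` times a bounded Wronskian. -/
theorem memLp_N (h : S.EndInterval J l c σ) {z : ℂ} (hv : S.IsSolution z v)
    (hv0 : ∀ x ∈ insert c J, v x ≠ 0) (hint : S.invSqIntegral v J < ⊤)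
    (hv2 : MemLp v 2 (S.weight.restrict J)) {g : ℝ → ℂ} (hg : S.MemDomMax g) :
    MemLp (S.N v g) 2 (volume.restrict J) := by
  obtain ⟨C, hC⟩ := h.exists_bound_wronskian hv hv2 hg
  have h1 := memLp_inv_sqrt_mul_inv h.measurableSet h.subset (hv.1.1.continuousOn.mono h.subset)
    (fun x hx => hv0 x (Or.inr hx)) hint
  have hW : AEStronglyMeasurable (S.wronskian v g) (volume.restrict J) :=
    ((ACloc.wronskian hv.1 hg.2.1).continuousOn.mono h.subset).aestronglyMeasurable
      h.measurableSet
  refine (MemLp.ae_eq ?_ (MemLp.of_le_mul (c := C) h1 (h1.1.mul hW) ?_))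
  · filter_upwards [h.ae_N_eq hv.1 hv0 hg.2.1] with x hx
    exact hx.symm
  · filter_upwards [ae_restrict_mem h.measurableSet] with x hx
    rw [Pi.mul_apply, norm_mul, mul_comm]
    exact mul_le_mul_of_nonneg_right (hC x hx) (norm_nonneg _)

/-- Integration by parts of `(f, τ g)` near an endpoint. -/
theorem integral_conj_mul_tau (h : S.EndInterval J l c σ) {lam : ℝ}
    (hv : S.IsRealSolution lam v)
    (hv0 : ∀ x ∈ insert c J, v x ≠ 0) (hint : S.invSqIntegral v J < ⊤)
    (hv2 : MemLp v 2 (S.weight.restrict J)) {f g : ℝ → ℂ} (hf2 : MemLp f 2 S.weight)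
    (hf : S.ACloc f) (hN : MemLp (S.N v f) 2 (volume.restrict J)) (hg : S.MemDomMax g)
    {A B : ℂ} (hA : HasBoundaryValue l v f A) (hB : S.HasBoundaryDeriv l v g B) :
    ∫ x in J, (S.r x : ℂ) * (conj (f x) * S.tau g x) =
      (∫ x in J, conj (S.N v f x) * S.N v g x)
      + (lam : ℂ) * (∫ x in J, (S.r x : ℂ) * (conj (f x) * g x))
      + σ * (conj A * B - (conj (f c) * S.quasiDeriv g c
        - S.quasiDeriv v c / v c * (conj (f c) * g c))) := by
  have := h.neBot
  set G : ℝ → ℂ := fun x => conj (f x / v x) * S.wronskian v g x with hG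
  -- Since `v` is real, the factor `conj v` in the denominator of `G` cancels against the `v` coming
  -- from `W(v,g)` and its derivative.
  have hconj : ∀ x ∈ S.I, conj (v x) = v x := fun x hx => Complex.conj_eq_iff_im.2 (hv.2 x hx)
  have hfr := memLp_conj (hf2.restrict J)
  have i1 : IntegrableOn (fun x => conj (S.N v f x) * S.N v g x) J :=
    (memLp_conj hN).integrable_mul (h.memLp_N hv.1 hv0 hint hv2 hg)
  have i2 := integrableOn_r_mul h.measurableSet h.subset hfr (hg.1.restrict J)
  have i3 := integrableOn_r_mul h.measurableSet h.subset hfr (hg.2.2.restrict J)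
  have hd : deriv G =ᵐ[volume.restrict J] fun x => conj (S.N v f x) * S.N v g x
      + (lam : ℂ) * ((S.r x : ℂ) * (conj (f x) * g x))
      - (S.r x : ℂ) * (conj (f x) * S.tau g x) := by
    filter_upwards [h.ae_hasDerivAt_div hv.1.1.1 hv0 hf, h.ae_N_eq hv.1.1 hv0 hg.2.1,
      h.ae_hasDerivAt_wronskian_solution hv.1 hg.2.1, ae_restrict_mem h.measurableSet]
      with x h1 h2 h3 hx
    have hvx := hv0 x (Or.inr hx)
    have hcx := hconj x (h.subset hx)
    have h4 : HasDerivAt (fun y => conj (f y / v y))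
        (conj ((Real.sqrt (S.p x) : ℂ)⁻¹ * (v x)⁻¹ * S.N v f x)) x := h1.star
    have h5 : deriv G x = _ := (h4.mul h3).deriv
    rw [h5, h2]
    simp only [map_mul, map_inv₀, map_div₀, Complex.conj_ofReal, hcx]
    field_simp
    ring
  have hlim := h.tendsto G (fun x hx =>
    (h.absolutelyContinuous_div hv.1.1.1 hv0 hf x hx).complex_conj.complex_mul
      (ACloc.wronskian hv.1.1 hg.2.1 x (h.subset hx) c h.base_mem))
    (((i1.add (i2.const_mul _)).sub i3).congr hd.symm)
  have hlim' : Tendsto G l (𝓝 (conj A * B)) :=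
    ((Complex.continuous_conj.tendsto A).comp hA).mul hB
  -- The limit of `G` is computed twice: from the boundary values, and as `G c` minus `σ` times the
  -- integral of `G'`.
  have key := tendsto_nhds_unique hlim' hlim
  have hsum : ∫ x in J, deriv G x = (∫ x in J, conj (S.N v f x) * S.N v g x)
      + (lam : ℂ) * (∫ x in J, (S.r x : ℂ) * (conj (f x) * g x))
      - ∫ x in J, (S.r x : ℂ) * (conj (f x) * S.tau g x) := by
    rw [integral_congr_ae hd, ← integral_const_mul, ← integral_add i1 (i2.const_mul _)]
    exact integral_sub (i1.add (i2.const_mul _)) i3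
  rw [hsum] at key
  have hGc : G c = conj (f c) * S.quasiDeriv g c
        - S.quasiDeriv v c / v c * (conj (f c) * g c) := by
    have hvc := hv0 c (Or.inl rfl)
    simp only [hG, wronskian, map_div₀, hconj c h.base_mem]
    field_simp
  rw [← hGc]
  -- Multiplying `key` by `σ` and using `σ² = 1` solves it for the integral.
  linear_combination ((∫ x in J, conj (S.N v f x) * S.N v g x)
      + (lam : ℂ) * (∫ x in J, (S.r x : ℂ) * (conj (f x) * g x))
      - ∫ x in J, (S.r x : ℂ) * (conj (f x) * S.tau g x)) * h.sign_sq - σ * key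

end EndInterval

/-! ### Integrability of `p⁻¹ v⁻²` for the nonprincipal solutions. -/

theorem invSqIntegral_Icc_lt_top {v : ℝ → ℂ} {x y : ℝ} (hx : x ∈ S.I) (hy : y ∈ S.I)
    (hv : ContinuousOn v S.I) (hv0 : ∀ t ∈ Set.Icc x y, v t ≠ 0) :
    S.invSqIntegral v (Set.Icc x y) < ⊤ := by
  have hI := Icc_subset_I hx hy
  have hi : IntegrableOn (fun t => (S.p t)⁻¹ * (‖v t‖ ^ 2)⁻¹) (Set.Icc x y) :=
    (S.locInt_inv_p.integrableOn_compact_subset hI isCompact_Icc).mul_continuousOn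
      (((hv.mono hI).norm.pow 2).inv₀ fun t ht => pow_ne_zero 2 (norm_ne_zero_iff.2 (hv0 t ht)))
      isCompact_Icc
  exact (lintegral_mono fun t => Real.ofReal_le_enorm _).trans_lt hi.2

theorem invSqIntegral_lt_top_of_subset_union {v : ℝ → ℂ} {J K : Set ℝ} {x y : ℝ}
    (hJ : J ⊆ K ∪ Set.Icc x y) (hK : S.invSqIntegral v K < ⊤) (hx : x ∈ S.I) (hy : y ∈ S.I)
    (hv : ContinuousOn v S.I) (hv0 : ∀ t ∈ Set.Icc x y, v t ≠ 0) :
    S.invSqIntegral v J < ⊤ :=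
  ((lintegral_mono_set hJ).trans (lintegral_union_le _ _ _)).trans_lt
    (ENNReal.add_lt_top.2 ⟨hK, invSqIntegral_Icc_lt_top hx hy hv hv0⟩)

/-- Pointwise `‖v‖⁻² ≤ 4 ‖w‖⁻²`; the 4 is the square of the factor 2 in the hypothesis. -/
theorem invSqIntegral_lt_top_of_norm_le {v w : ℝ → ℂ} {J : Set ℝ} (hJ : MeasurableSet J)
    (hJI : J ⊆ S.I) (hw0 : ∀ x ∈ J, w x ≠ 0) (h : ∀ x ∈ J, ‖w x‖ ≤ 2 * ‖v x‖)
    (hw : S.invSqIntegral w J < ⊤) : S.invSqIntegral v J < ⊤ := by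
  have h4 : ∫⁻ x in J, 4 * ENNReal.ofReal ((S.p x)⁻¹ * (‖w x‖ ^ 2)⁻¹) < ⊤ := by
    rw [lintegral_const_mul' _ _ (by norm_num)]
    exact ENNReal.mul_lt_top (by norm_num) hw
  refine lt_of_le_of_lt (lintegral_mono_ae ?_) h4
  filter_upwards [ae_restrict_mem hJ, ae_restrict_of_ae_restrict_of_subset hJI S.p_pos] with x hx hp
  have hwx : 0 < ‖w x‖ := norm_pos_iff.2 (hw0 x hx)
  rw [show (4 : ENNReal) = ENNReal.ofReal 4 by norm_num, ← ENNReal.ofReal_mul (by norm_num)]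
  refine ENNReal.ofReal_le_ofReal ?_
  rw [mul_left_comm]
  refine mul_le_mul_of_nonneg_left ?_ (inv_pos.2 hp).le
  have hvx : 0 < ‖v x‖ := by linarith [h x hx]
  rw [← div_eq_mul_inv, inv_eq_one_div, div_le_div_iff₀ (by positivity) (by positivity)]
  nlinarith [h x hx]

/-- If `W(v,u) = W(u,w) = 1` and `u = o(w)` at an endpoint, then `w = O(v)` there. -/
theorem eventually_norm_le_of_wronskian_eq_one {l : Filter ℝ} {z : ℂ} {u v w : ℝ → ℂ}
    (hlI : S.I ∈ l) (hv : S.IsSolution z v) (hw : S.IsSolution z w)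
    (hvu : ∀ x ∈ S.I, S.wronskian v u x = 1) (huw : ∀ x ∈ S.I, S.wronskian u w x = 1)
    (ho : u =o[l] w) : ∀ᶠ x in l, ‖w x‖ ≤ 2 * ‖v x‖ := by
  by_cases hne : S.I.Nonempty
  swap
  · rw [Set.not_nonempty_iff_eq_empty.1 hne] at hlI
    exact mem_of_superset hlI (Set.empty_subset _)
  obtain ⟨t, ht⟩ := hne
  -- The Wronskian of `w` and `v` is a constant `κ`, evaluated at `t`, and `w = -κ u - v`. With `‖κ
  -- u‖ ≤ ‖w‖ / 2` near the endpoint, half of `‖w‖` is absorbed on the left, whence the factor 2.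
  filter_upwards [hlI, (ho.const_mul_left (S.wronskian w v t)).bound (c := 1 / 2) (by norm_num)]
    with x hx hb
  have e : w x = -(S.wronskian w v t * u x) - v x := by
    have h1 := hvu x hx
    have h2 := huw x hx
    rw [wronskian_const hw hv ht hx]
    simp only [wronskian] at h1 h2 ⊢
    linear_combination (-w x) * h1 - v x * h2
  have h3 : ‖w x‖ ≤ ‖S.wronskian w v t * u x‖ + ‖v x‖ := by
    conv_lhs => rw [e]
    exact (norm_sub_le _ _).trans (by rw [norm_neg])
  linarith

/-- Near `a` the companion of the principal solution dominates the integrand; on the remaining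
compact piece `[e,c]`, `v` is continuous without zeros and `1/p` is integrable. -/
theorem invSqIntegral_left_lt_top {lam : ℝ} {u v : ℝ → ℂ} {c : ℝ} (hc : c ∈ S.I)
    (hu : S.IsPrincipalLeft lam u) (hv : S.IsSolution lam v)
    (hvu : ∀ x ∈ S.I, S.wronskian v u x = 1) (hv0 : ∀ x ∈ insert c (S.left c), v x ≠ 0) :
    S.invSqIntegral v (S.left c) < ⊤ := by
  obtain ⟨-, w, hw, c₀, hc₀, hne, huw, ho, hfin⟩ := hu
  have hev := eventually_norm_le_of_wronskian_eq_one
    (mem_of_superset (left_mem_atLeft hc) (left_subset_I hc)) hv hw.1 hvu huw ho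
  obtain ⟨e, he, hle, hb⟩ := exists_left_of_eventually hev (c := min c c₀)
    ((min_choice c c₀).elim (fun h => h.symm ▸ hc) (fun h => h.symm ▸ hc₀))
  have hec₀ := hle.trans (min_le_right _ _)
  refine invSqIntegral_lt_top_of_subset_union (K := S.left e) (x := e) (y := c) ?_ ?_ he hc
    hv.1.1.continuousOn ?_
  · exact fun x hx => (lt_or_ge x e).imp (fun h => ⟨hx.1, h⟩) (fun h => ⟨h, hx.2.le⟩)
  · exact invSqIntegral_lt_top_of_norm_le (S.measurableSet_left e) (left_subset_I he)
      (fun x hx => (hne x (left_subset_I he hx) (hx.2.le.trans hec₀)).2) hb (hfin e he hec₀).2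
  · refine fun x hx => hv0 x (hx.2.eq_or_lt.imp id fun h => ⟨?_, h⟩)
    exact he.1.trans_le (EReal.coe_le_coe_iff.2 hx.1)

theorem invSqIntegral_right_lt_top {lam : ℝ} {u v : ℝ → ℂ} {d : ℝ} (hd : d ∈ S.I)
    (hu : S.IsPrincipalRight lam u) (hv : S.IsSolution lam v)
    (hvu : ∀ x ∈ S.I, S.wronskian v u x = 1) (hv0 : ∀ x ∈ insert d (S.right d), v x ≠ 0) :
    S.invSqIntegral v (S.right d) < ⊤ := by
  obtain ⟨-, w, hw, d₀, hd₀, hne, huw, ho, hfin⟩ := hu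
  have hev := eventually_norm_le_of_wronskian_eq_one
    (mem_of_superset (right_mem_atRight hd) (right_subset_I hd)) hv hw.1 hvu huw ho
  obtain ⟨e, he, hle, hb⟩ := exists_right_of_eventually hev (d := max d d₀)
    ((max_choice d d₀).elim (fun h => h.symm ▸ hd) (fun h => h.symm ▸ hd₀))
  have hed₀ := (le_max_right _ _).trans hle
  refine invSqIntegral_lt_top_of_subset_union (K := S.right e) (x := d) (y := e) ?_ ?_ hd he
    hv.1.1.continuousOn ?_
  · exact fun x hx => (lt_or_ge e x).imp (fun h => ⟨h, hx.2⟩) (fun h => ⟨hx.1.le, h⟩)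
  · exact invSqIntegral_lt_top_of_norm_le (S.measurableSet_right e) (right_subset_I he)
      (fun x hx => (hne x (right_subset_I he hx) (hed₀.trans hx.1.le)).2) hb (hfin e he hed₀).2
  · refine fun x hx => hv0 x (hx.1.eq_or_lt.imp Eq.symm fun h => ⟨h, ?_⟩)
    exact (EReal.coe_le_coe_iff.2 hx.2).trans_lt he.2

/-! ### Square integrability and integration by parts on compact subintervals. -/

/-- Local integrability of `r` makes the weight finite on compact subintervals, where a continuous
`v` is bounded. -/
theorem memLp_weight_Icc {v : ℝ → ℂ} {x y : ℝ} (hx : x ∈ S.I) (hy : y ∈ S.I)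
    (hv : ContinuousOn v S.I) : MemLp v 2 (S.weight.restrict (Set.Icc x y)) := by
  have hI := Icc_subset_I hx hy
  have hm : AEStronglyMeasurable v (S.weight.restrict (Set.Icc x y)) :=
    (hv.mono hI).aestronglyMeasurable measurableSet_Icc
  have h1 : Integrable (fun _ => (1 : ℂ)) (S.weight.restrict (Set.Icc x y)) := by
    rw [integrable_weight_restrict_iff measurableSet_Icc hI]
    simp only [mul_one]
    exact (S.locInt_r.integrableOn_compact_subset hI isCompact_Icc).ofReal
  have hfin : IsFiniteMeasure (S.weight.restrict (Set.Icc x y)) :=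
    (integrable_const_iff.1 h1).resolve_left one_ne_zero
  obtain ⟨C, hC⟩ := isCompact_Icc.exists_bound_of_continuousOn (hv.mono hI)
  exact MemLp.of_bound hm C ((ae_restrict_mem measurableSet_Icc).mono hC)

theorem memLp_weight_of_subset_union {v : ℝ → ℂ} {J K : Set ℝ} {x y : ℝ}
    (hJ : J ⊆ K ∪ Set.Icc x y) (hK : MemLp v 2 (S.weight.restrict K)) (hx : x ∈ S.I)
    (hy : y ∈ S.I) (hv : ContinuousOn v S.I) : MemLp v 2 (S.weight.restrict J) := by
  have hI := memLp_weight_Icc hx hy hv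
  have h : MemLp v 2 (S.weight.restrict K + S.weight.restrict (Set.Icc x y)) :=
    (memLp_two_iff_integrable_sq_norm (hK.1.add_measure hI.1)).2
      (((memLp_two_iff_integrable_sq_norm hK.1).1 hK).add_measure
        ((memLp_two_iff_integrable_sq_norm hI.1).1 hI))
  exact h.mono_measure ((Measure.restrict_mono_set _ hJ).trans (Measure.restrict_union_le _ _))

theorem memLp_inv_sqrt_mul_quasiDeriv {g : ℝ → ℂ} (hg : S.MemD g) {c d : ℝ} (hc : c ∈ S.I)
    (hd : d ∈ S.I) : MemLp (fun x => ((Real.sqrt (S.p x))⁻¹ : ℂ) * S.quasiDeriv g x) 2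
      (volume.restrict (Set.Ioo c d)) := by
  have hI := Icc_subset_I hc hd
  have hI' : Set.Ioo c d ⊆ S.I := Set.Ioo_subset_Icc_self.trans hI
  have hcont := hg.isQuasiDeriv.1.continuousOn
  obtain ⟨C, hC⟩ := isCompact_Icc.exists_bound_of_continuousOn (hcont.mono hI)
  -- The choice `v = 1` expresses local integrability of `1/p` as `p^{-1/2} ∈ L²`; the continuous
  -- quasi-derivative is then a bounded factor.
  have h1 : MemLp (fun x => (Real.sqrt (S.p x) : ℂ)⁻¹ * (1 : ℂ)⁻¹) 2
      (volume.restrict (Set.Ioo c d)) :=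
    memLp_inv_sqrt_mul_inv (v := fun _ => 1) measurableSet_Ioo hI' continuousOn_const
      (fun _ _ => one_ne_zero)
      ((lintegral_mono_set Set.Ioo_subset_Icc_self).trans_lt
        (invSqIntegral_Icc_lt_top hc hd continuousOn_const fun _ _ => one_ne_zero))
  simp only [inv_one, mul_one] at h1
  refine MemLp.of_le_mul (c := C) h1
    (h1.1.mul ((hcont.mono hI').aestronglyMeasurable measurableSet_Ioo)) ?_
  filter_upwards [ae_restrict_mem measurableSet_Ioo] with x hx
  rw [norm_mul, mul_comm]
  exact mul_le_mul_of_nonneg_right (hC x (Set.Ioo_subset_Icc_self hx)) (norm_nonneg _)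

/-- Integration by parts of `(f, τ g)` on a compact subinterval. -/
theorem integral_conj_mul_tau_Ioo {f g : ℝ → ℂ} {c d : ℝ} (hc : c ∈ S.I) (hd : d ∈ S.I)
    (hcd : c ≤ d) (hf2 : MemLp f 2 S.weight) (hf : S.ACloc f)
    (hf1 : MemLp (fun x => ((Real.sqrt (S.p x))⁻¹ : ℂ) * S.quasiDeriv f x) 2
      (volume.restrict (Set.Ioo c d))) (hg : S.MemDomMax g) :
    ∫ x in Set.Ioo c d, (S.r x : ℂ) * (conj (f x) * S.tau g x) =
      (∫ x in Set.Ioo c d, (((S.p x)⁻¹ : ℝ) * (conj (S.quasiDeriv f x) * S.quasiDeriv g x)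
        + (S.q x : ℂ) * (conj (f x) * g x)))
      + conj (f c) * S.quasiDeriv g c - conj (f d) * S.quasiDeriv g d := by
  have hI := Icc_subset_I hc hd
  have hI' : Set.Ioo c d ⊆ S.I := Set.Ioo_subset_Icc_self.trans hI
  have hp := ae_restrict_of_ae_restrict_of_subset hI' S.p_pos
  have i3 := integrableOn_r_mul measurableSet_Ioo hI' (memLp_conj (hf2.restrict (Set.Ioo c d)))
    (hg.2.2.restrict (Set.Ioo c d))
  have i1 : IntegrableOn
      (fun x => ((S.p x)⁻¹ : ℝ) * (conj (S.quasiDeriv f x) * S.quasiDeriv g x))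
      (Set.Ioo c d) := by
    refine ((memLp_conj hf1).integrable_mul
      (memLp_inv_sqrt_mul_quasiDeriv hg.2.1 hc hd)).congr ?_
    filter_upwards [hp] with x hx
    -- Splitting `1/p` into two factors `p^{-1/2}` exhibits the integrand as a product of two L²
    -- functions.
    have hs : (((S.p x)⁻¹ : ℝ) : ℂ) = (Real.sqrt (S.p x) : ℂ)⁻¹ * (Real.sqrt (S.p x) : ℂ)⁻¹ := by
      rw [← mul_inv, Complex.ofReal_inv]
      congr 1
      exact_mod_cast (Real.mul_self_sqrt hx.le).symm
    simp only [Pi.mul_apply, map_mul, map_inv₀, Complex.conj_ofReal]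
    rw [hs]; ring
  have i2 : IntegrableOn (fun x => (S.q x : ℂ) * (conj (f x) * g x)) (Set.Ioo c d) := by
    have hq : IntegrableOn (fun x => (S.q x : ℂ)) (Set.Icc c d) :=
      (S.locInt_q.integrableOn_compact_subset hI isCompact_Icc).ofReal
    exact (hq.mul_continuousOn ((hf.star_comp.mul hg.2.1.1).continuousOn.mono hI)
      isCompact_Icc).mono_set Set.Ioo_subset_Icc_self
  have hFTC := (hf.star_comp.mul hg.2.1.isQuasiDeriv.1 c hc d hd).complex_integral_deriv_eq_sub
  have hd' : deriv (fun x => conj (f x) * S.quasiDeriv g x) =ᵐ[volume.restrict (Set.Ioo c d)]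
      fun x => (((S.p x)⁻¹ : ℝ) * (conj (S.quasiDeriv f x) * S.quasiDeriv g x)
        + (S.q x : ℂ) * (conj (f x) * g x)) - (S.r x : ℂ) * (conj (f x) * S.tau g x) := by
    filter_upwards [hp, ae_restrict_of_ae_restrict_of_subset hI' hf.ae_differentiableAt,
      ae_restrict_of_ae_restrict_of_subset hI' (S.quasiDeriv_ae_eq f),
      ae_restrict_of_ae_restrict_of_subset hI' hg.2.1.ae_hasDerivAt] with x hx h1 h2 h3
    have hp' : (S.p x : ℂ) ≠ 0 := by exact_mod_cast hx.ne'
    have h4 : HasDerivAt (fun y => conj (f y)) (conj (deriv f x)) x := h1.hasDerivAt.star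
    have h5 : deriv (fun x => conj (f x) * S.quasiDeriv g x) x = _ := (h4.mul h3.2).deriv
    rw [h5, h2, Complex.ofReal_inv, map_mul, Complex.conj_ofReal]
    field_simp
    ring
  rw [intervalIntegral.integral_of_le hcd, integral_Ioc_eq_integral_Ioo,
    integral_congr_ae hd'] at hFTC
  have hsub := integral_sub (i1.add i2) i3
  simp only [Pi.add_apply] at hsub
  rw [hsub] at hFTC
  linear_combination -hFTC

theorem setIntegral_I_eq {F : ℝ → ℂ} (hF : IntegrableOn F S.I) {c d : ℝ} (hc : c ∈ S.I)
    (hd : d ∈ S.I) (hcd : c < d) :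
    ∫ x in S.I, F x = (∫ x in S.left c, F x) + (∫ x in Set.Ioo c d, F x)
      + ∫ x in S.right d, F x := by
  have hU : S.I = S.left c ∪ Set.Icc c d ∪ S.right d := by
    refine Set.Subset.antisymm (fun x hx => ?_)
      (Set.union_subset (Set.union_subset (left_subset_I hc) (Icc_subset_I hc hd))
        (right_subset_I hd))
    rcases lt_or_ge x c with h | h
    · exact Or.inl (Or.inl ⟨hx.1, h⟩)
    · exact (le_or_gt x d).imp (fun h' => Or.inr ⟨h, h'⟩) (fun h' => ⟨h', hx.2⟩)
  have hl := hF.mono_set (left_subset_I hc)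
  have hm := hF.mono_set (Icc_subset_I hc hd)
  have d1 : Disjoint (S.left c) (Set.Icc c d) :=
    Set.disjoint_left.2 fun x h1 h2 => h1.2.not_ge h2.1
  have d2 : Disjoint (S.left c ∪ Set.Icc c d) (S.right d) :=
    Set.disjoint_left.2 fun x h1 h2 =>
      h1.elim (fun h => (h.2.trans hcd).not_gt h2.1) fun h => h.2.not_gt h2.1
  rw [← integral_Icc_eq_integral_Ioo, ← setIntegral_union d1 measurableSet_Icc hl hm,
    ← setIntegral_union d2 (S.measurableSet_right d) (hl.union hm)
      (hF.mono_set (right_subset_I hd)), ← hU]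

end SturmLiouville

/-! ### Assembly of the three pieces. -/

theorem lemma3p3 (S : SturmLiouville)
    (hlca : S.LimitCircleLeft) (hlcb : S.LimitCircleRight)
    (lam0 : ℝ) (hmin : S.MinBoundedBelow lam0)
    (ua va ub vb : ℝ → ℂ)
    (hua : S.IsPrincipalLeft lam0 ua) (hva : S.IsNonprincipalLeft lam0 va)
    (hub : S.IsPrincipalRight lam0 ub) (hvb : S.IsNonprincipalRight lam0 vb)
    (hWa : ∀ x ∈ S.I, S.wronskian va ua x = 1)
    (hWb : ∀ x ∈ S.I, S.wronskian vb ub x = 1)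
    (a0 b0 : ℝ) (ha0 : a0 ∈ S.I) (hb0 : b0 ∈ S.I) (hab0 : a0 < b0)
    (hnza : ∀ x ∈ S.left a0, ua x ≠ 0 ∧ va x ≠ 0)
    (hnzb : ∀ x ∈ S.right b0, ub x ≠ 0 ∧ vb x ≠ 0)
    (c d : ℝ) (hc : c ∈ S.left a0) (hd : d ∈ S.right b0)
    (f g : ℝ → ℂ) (hf : S.MemDomQ va vb c d f) (hg : S.MemDomMax g) :
    S.MemDomQ va vb c d g ∧
    ∃ fa fb ga' gb' : ℂ,
      SturmLiouville.HasBoundaryValue S.atLeft va f fa ∧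
      SturmLiouville.HasBoundaryValue S.atRight vb f fb ∧
      S.HasBoundaryDeriv S.atLeft va g ga' ∧
      S.HasBoundaryDeriv S.atRight vb g gb' ∧
      S.innerL2 f (S.tau g) =
        S.Q lam0 va vb c d f g + (starRingEnd ℂ) fa * ga' - (starRingEnd ℂ) fb * gb' := by
  have hcI := SturmLiouville.left_subset_I ha0 hc
  have hdI := SturmLiouville.right_subset_I hb0 hd
  have hcd : c < d := hc.2.trans (hab0.trans hd.1)
  have hva0 : ∀ x ∈ insert c (S.left c), va x ≠ 0 := by
    rintro x (rfl | hx)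
    · exact (hnza _ hc).2
    · exact (hnza x ⟨hx.1, hx.2.trans hc.2⟩).2
  have hvb0 : ∀ x ∈ insert d (S.right d), vb x ≠ 0 := by
    rintro x (rfl | hx)
    · exact (hnzb _ hd).2
    · exact (hnzb x ⟨hd.1.trans hx.1, hx.2⟩).2
  have hia := SturmLiouville.invSqIntegral_left_lt_top hcI hua hva.1.1 hWa hva0
  have hib := SturmLiouville.invSqIntegral_right_lt_top hdI hub hvb.1.1 hWb hvb0
  have hva2 : MemLp va 2 (S.weight.restrict (S.left c)) := by
    -- The limit circle case at `z = λ₀` gives L² only on some `(a,e)`; continuity on compact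
    -- subintervals extends this up to `c`.
    obtain ⟨e, he, h⟩ := hlca lam0 va hva.1.1
    exact SturmLiouville.memLp_weight_of_subset_union
      (fun x hx => (lt_or_ge x e).imp id fun h' => ⟨h', hx.2.le⟩) h he hcI
      hva.1.1.1.1.continuousOn
  have hvb2 : MemLp vb 2 (S.weight.restrict (S.right d)) := by
    obtain ⟨e, he, h⟩ := hlcb lam0 vb hvb.1.1
    exact SturmLiouville.memLp_weight_of_subset_union
      (fun x hx => (lt_or_ge e x).imp id fun h' => ⟨hx.1.le, h'⟩) h hdI he
      hvb.1.1.1.1.continuousOn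
  have ha := SturmLiouville.endInterval_left hcI
  have hb := SturmLiouville.endInterval_right hdI
  obtain ⟨hf2, hfac, hf1, hfa, hfb⟩ := hf
  obtain ⟨fa, hfA⟩ := ha.exists_boundaryValue hva.1.1.1.1 hva0 hia hfac hfa
  obtain ⟨fb, hfB⟩ := hb.exists_boundaryValue hvb.1.1.1.1 hvb0 hib hfac hfb
  obtain ⟨ga, hgA⟩ := ha.exists_boundaryDeriv hva.1.1 hva2 hg
  obtain ⟨gb, hgB⟩ := hb.exists_boundaryDeriv hvb.1.1 hvb2 hg
  refine ⟨⟨hg.1, hg.2.1.1, SturmLiouville.memLp_inv_sqrt_mul_quasiDeriv hg.2.1 hcI hdI,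
    ha.memLp_N hva.1.1 hva0 hia hva2 hg, hb.memLp_N hvb.1.1 hvb0 hib hvb2 hg⟩,
    fa, fb, ga, gb, hfA, hfB, hgA, hgB, ?_⟩
  have hint := SturmLiouville.integrableOn_r_mul S.measurableSet_I subset_rfl
    (SturmLiouville.memLp_conj (hf2.restrict S.I)) (hg.2.2.restrict S.I)
  rw [SturmLiouville.innerL2, S.integral_weight, SturmLiouville.setIntegral_I_eq hint hcI hdI hcd,
    ha.integral_conj_mul_tau hva.1 hva0 hia hva2 hf2 hfac hfa hg hfA hgA,
    hb.integral_conj_mul_tau hvb.1 hvb0 hib hvb2 hf2 hfac hfb hg hfB hgB,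
    SturmLiouville.integral_conj_mul_tau_Ioo hcI hdI hcd.le hf2 hfac hf1 hg, SturmLiouville.Q]
  -- The terms `conj (f c) * g^[1] c` and `conj (f d) * g^[1] d` from the end pieces cancel against
  -- those of the middle piece, leaving the point terms of `Q` and the boundary terms.
  ring
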